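/- A permutation $\pi=\pi_1\cdots\pi_n$ of $\{1,\dots,n\}$ has $\mathrm{peak}(\pi)=|\{j : 1<j<n,\ \pi_j>\max\{\pi_{j-1},\pi_{j+1}\}\}|$ peaks and $\mathrm{val}(\pi)=|\{j : 1<j<n,\ \pi_j<\min\{\pi_{j-1},\pi_{j+1}\}\}|$ valleys. Let $e$ denote either of the two statistics $\mathrm{peak}$, $\mathrm{val}$, and let $$P(x,y)=\sum_{n\ge 0}\ \sum_{\pi\in\mathcal S_n} y^{e(\pi)}\,\frac{x^n}{n!}$$ be its bivariate generating function (exponential in $x$; $\mathcal S_n$ is the set of all permutations of $\{1,\dots,n\}$, with $\mathcal S_0$ consisting of the empty permutation). Then $$P(x,y)=1-\frac1y+\frac1y\,\sqrt{y-1}\,\tan\!\left(x\sqrt{y-1}+\arctan\frac1{\sqrt{y-1}}\right).$$ More precisely, for all complex $y\notin\{0,1\}$, for either choice of the square root $\sqrt{y-1}$, and for all complex $x$ with $|x|<1$ and $|y|\,|x|^2<1$, the series $P(x,y)$ converges (over $n$, absolutely) and its sum is the right-hand side. -/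

import Mathlib

/-- The number of peaks of a permutation `π` of `Fin n`: the number of interior positions `j`
with `π j > max {π (j - 1), π (j + 1)}`. -/
def numPeaks {n : ℕ} (π : Equiv.Perm (Fin n)) : ℕ :=
  (Finset.univ.filter fun j : Fin n =>
    ∃ i k : Fin n, (i : ℕ) + 1 = j ∧ (j : ℕ) + 1 = k ∧ max (π i) (π k) < π j).card

/-- The number of valleys of a permutation `π` of `Fin n`: the number of interior positions `j`
with `π j < min {π (j - 1), π (j + 1)}`. -/
def numValleys {n : ℕ} (π : Equiv.Perm (Fin n)) : ℕ :=
  (Finset.univ.filter fun j : Fin n =>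
    ∃ i k : Fin n, (i : ℕ) + 1 = j ∧ (j : ℕ) + 1 = k ∧ π j < min (π i) (π k)).card

/-! Cut a permutation at its maximum: the two sides are arbitrary arrangements of complementary
sets, and the maximum is a peak exactly when both are nonempty. Hence `P' = 1 + 2(P - 1) + y(P -
1)^2` as formal series. With `s^2 = y - 1`, `c = cos(sx)` and `d = sin(sx)/s`, this Riccati equation
is solved by `P (c - d) = c` (`peakSeries_mul`). Since there are at most `n/2` peaks, `P` converges
absolutely in the stated region, and a Cauchy product turns the formal identity into a numerical
one. Valleys are peaks after reversing the values. -/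

/-- The number of interior entries of a list that exceed both neighbours. -/
def List.peakCount {α : Type*} [LinearOrder α] : List α → ℕ
  | a :: b :: c :: l => (if max a c < b then 1 else 0) + List.peakCount (b :: c :: l)
  | _ => 0

namespace List

variable {α : Type*} [LinearOrder α]

theorem peakCount_cons_of_head_lt {m : α} {l : List α} (h : ∀ a ∈ l, a < m) :
    peakCount (m :: l) = peakCount l := by
  match l with
  | [] => rfl
  | [b] => rfl
  | b :: c :: l =>
    have hb : ¬ max m c < b := fun h' => absurd (h b (by simp)) (max_lt_iff.1 h').1.not_gt
    simp [peakCount, hb]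

/-- The neighbours of `m` are not peaks, and as end entries of `l₁` and `l₂` they were not counted
there either; only `m` itself can contribute. -/
theorem peakCount_append_cons {m : α} : ∀ {l₁ l₂ : List α}, (∀ a ∈ l₁, a < m) →
    (∀ a ∈ l₂, a < m) → peakCount (l₁ ++ m :: l₂) =
      peakCount l₁ + peakCount l₂ + if l₁ = [] ∨ l₂ = [] then 0 else 1
  | [], l₂, _, h₂ => by simpa [peakCount] using peakCount_cons_of_head_lt h₂
  | [a], [], _, _ => by simp [peakCount]
  | [a], b :: l, h₁, h₂ => by
    have := peakCount_cons_of_head_lt h₂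
    have ha : a < m := h₁ a (by simp)
    have hb : b < m := h₂ b (by simp)
    simp only [cons_append, nil_append, peakCount, this]
    simp [ha, hb, add_comm]
  | [a, b], l₂, h₁, h₂ => by
    have ih := peakCount_append_cons (l₁ := [b]) (fun x hx => h₁ x (by simp_all)) h₂
    have hb : ¬ max a m < b := fun h' =>
      absurd (h₁ b (by simp)) (max_lt_iff.1 h').2.not_gt
    simp only [cons_append, nil_append] at ih
    simp only [cons_append, nil_append, peakCount, hb, ih]
    simp
  | a :: b :: c :: l, l₂, h₁, h₂ => by
    have ih := peakCount_append_cons (l₁ := b :: c :: l)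
      (fun x hx => h₁ x (mem_cons_of_mem _ hx)) h₂
    simp only [cons_append] at ih
    simp only [cons_append, peakCount, ih]
    simp [add_assoc]

/-- Adjacent entries cannot both be peaks, so a peak at `b` lets the induction drop two entries. -/
theorem two_mul_peakCount_le : ∀ l : List α, 2 * l.peakCount ≤ l.length
  | [] => by simp [peakCount]
  | [a] => by simp [peakCount]
  | [a, b] => by simp [peakCount]
  | [a, b, c] => by simp only [peakCount, length]; split_ifs <;> simp
  | a :: b :: c :: d :: l => by
    have h₁ := two_mul_peakCount_le (b :: c :: d :: l)
    have h₂ := two_mul_peakCount_le (c :: d :: l)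
    simp only [peakCount, length] at *
    by_cases h : max a c < b
    · have : ¬ max b d < c := fun h' => (max_lt_iff.1 h).2.not_gt (max_lt_iff.1 h').1
      simp only [h, this] at *
      simp at *
      omega
    · simp only [h] at *
      simp at *
      omega

theorem peakCount_ofFn : ∀ {n : ℕ} (f : Fin n → α), (ofFn f).peakCount =
    ∑ j : Fin n, if ∃ i k : Fin n, (i : ℕ) + 1 = j ∧ (j : ℕ) + 1 = k ∧ max (f i) (f k) < f j
      then 1 else 0
  | 0, f => by simp [peakCount]
  | 1, f => by simp [peakCount]
  | 2, f => by
    simp only [Fin.sum_univ_two, Fin.exists_fin_two]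
    simp [peakCount]
  | n + 3, f => by
    have ih := peakCount_ofFn fun i : Fin (n + 2) => f i.succ
    have h0 : ∀ (m : ℕ) (g : Fin (m + 1) → α), ¬ ∃ i k : Fin (m + 1),
        (i : ℕ) + 1 = (0 : Fin (m + 1)) ∧ ((0 : Fin (m + 1)) : ℕ) + 1 = k ∧
          max (g i) (g k) < g 0 := by
      rintro m g ⟨i, k, h, -⟩
      simp at h
    rw [Fin.sum_univ_succ, if_neg (h0 _ _)] at ih
    rw [Fin.sum_univ_succ, if_neg (h0 _ _), Fin.sum_univ_succ]
    rw [show ofFn f = f 0 :: f 1 :: f 2 :: ofFn fun i : Fin n => f i.succ.succ.succ by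
      simp [ofFn_succ]]
    rw [show (ofFn fun i : Fin (n + 2) => f i.succ) =
      f 1 :: f 2 :: ofFn fun i : Fin n => f i.succ.succ.succ by simp [ofFn_succ]] at ih
    rw [peakCount, ih, zero_add, zero_add]
    congr 1
    · refine if_congr ⟨fun h => ⟨0, 2, rfl, rfl, h⟩, ?_⟩ rfl rfl
      rintro ⟨i, k, hi, hk, h⟩
      have hi : i = 0 := Fin.ext (by simpa using hi)
      have hk : k = 2 := Fin.ext hk.symm
      subst hi hk
      exact h
    · refine Finset.sum_congr rfl fun j _ => if_congr ?_ rfl rfl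
      constructor
      · rintro ⟨i, k, hi, hk, h⟩
        exact ⟨i.succ, k.succ, by simpa using hi, by simpa using hk, h⟩
      · rintro ⟨i, k, hi, hk, h⟩
        obtain ⟨i, rfl⟩ := Fin.exists_succ_eq.2 (show i ≠ 0 by rintro rfl; simp at hi)
        obtain ⟨k, rfl⟩ := Fin.exists_succ_eq.2 (show k ≠ 0 by rintro rfl; simp at hk)
        exact ⟨i, k, by simpa using hi, by simpa using hk, h⟩

end List

theorem peakCount_ofFn_perm {n : ℕ} (π : Equiv.Perm (Fin n)) :
    (List.ofFn π).peakCount = numPeaks π := by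
  rw [List.peakCount_ofFn, numPeaks, Finset.card_filter]

/-! ### Cutting arrangements at the maximum -/

/-- The lists that enumerate the elements of a finite set, each once. -/
def Finset.arrangements {α : Type*} [DecidableEq α] (s : Finset α) : Finset (List α) :=
  ⟨s.val.lists, Multiset.lists_nodup_finset s⟩

theorem Finset.mem_arrangements {α : Type*} [DecidableEq α] {s : Finset α} {l : List α} :
    l ∈ s.arrangements ↔ l.Nodup ∧ ∀ a, a ∈ l ↔ a ∈ s := by
  have : l ∈ s.arrangements ↔ s.val = (l : Multiset α) := by
    rw [← Finset.mem_val]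
    exact Multiset.mem_lists_iff _ _
  rw [this]
  constructor
  · intro h
    exact ⟨by rw [← Multiset.coe_nodup, ← h]; exact s.nodup,
      fun a => by rw [← Finset.mem_val, h, Multiset.mem_coe]⟩
  · rintro ⟨h, h'⟩
    exact (Multiset.Nodup.ext s.nodup (Multiset.coe_nodup.2 h)).2 fun a => by simp [h']

/-- `m` occurs once, so it splits each list uniquely; `t` is the set of entries to its left. -/
theorem Finset.sum_arrangements_insert {α M : Type*} [LinearOrder α] [AddCommMonoid M]
    {s : Finset α} {m : α} (hm : m ∉ s) (f : List α → M) :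
    ∑ l ∈ (insert m s).arrangements, f l =
      ∑ t ∈ s.powerset, ∑ p ∈ t.arrangements ×ˢ (s \ t).arrangements, f (p.1 ++ m :: p.2) := by
  rw [Finset.sum_sigma']
  symm
  refine Finset.sum_bij (fun x _ => x.2.1 ++ m :: x.2.2) ?_ ?_ ?_ fun _ _ => rfl
  · rintro ⟨t, l₁, l₂⟩ h
    simp only [mem_sigma, mem_powerset, mem_product, mem_arrangements, mem_sdiff] at h
    obtain ⟨hts, ⟨n₁, h₁⟩, n₂, h₂⟩ := h
    simp only [mem_arrangements, List.nodup_append, List.nodup_cons, List.mem_append,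
      List.mem_cons, mem_insert, h₁, h₂]
    refine ⟨⟨n₁, ⟨fun h => hm h.1, n₂⟩, ?_⟩, fun a => ?_⟩
    · rintro a ha b (rfl | hb) rfl
      · exact hm (hts ha)
      · exact hb.2 ha
    · have := @hts a
      tauto
  · rintro ⟨t, l₁, l₂⟩ h ⟨t', l₁', l₂'⟩ h' e
    simp only [mem_sigma, mem_powerset, mem_product, mem_arrangements, mem_sdiff] at h h'
    obtain ⟨hts, ⟨n₁, h₁⟩, n₂, h₂⟩ := h
    obtain ⟨hts', ⟨n₁', h₁'⟩, n₂', h₂'⟩ := h'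
    obtain ⟨rfl, -, rfl⟩ := (List.append_cons_inj_of_notMem
      (fun h => hm (hts ((h₁ _).1 h))) (fun h => hm ((h₂ _).1 h).1)).1 e
    obtain rfl : t = t' := by ext a; rw [← h₁, ← h₁']
    rfl
  · intro l hl
    rw [mem_arrangements] at hl
    obtain ⟨hn, hl⟩ := hl
    obtain ⟨l₁, l₂, rfl⟩ := List.append_of_mem ((hl m).2 (mem_insert_self _ _))
    simp only [List.nodup_append, List.nodup_cons, List.mem_append, List.mem_cons,
      mem_insert] at hn hl
    obtain ⟨n₁, ⟨hm₂, n₂⟩, hd⟩ := hn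
    have hs : ∀ a, a ∈ s ↔ a ∈ l₁ ∨ a ∈ l₂ := by
      intro a
      have := hl a
      by_cases ha : a = m
      · subst ha
        have : a ∉ l₁ := fun h => hd a h a (Or.inl rfl) rfl
        tauto
      · tauto
    refine ⟨⟨l₁.toFinset, l₁, l₂⟩, ?_, rfl⟩
    simp only [mem_sigma, mem_powerset, mem_product, mem_arrangements, mem_sdiff,
      List.mem_toFinset, hs]
    refine ⟨fun a ha => (hs a).2 (Or.inl (List.mem_toFinset.1 ha)), ⟨n₁, fun _ => trivial⟩,
      n₂, fun a => ⟨fun h => ⟨Or.inr h, fun h' => hd a h' a (Or.inr h) rfl⟩, by tauto⟩⟩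

/-- The polynomials counting permutations by peaks, defined by splitting at the maximum. -/
def peakPoly {R : Type*} [CommSemiring R] (y : R) : ℕ → R
  | 0 => 1
  | n + 1 => ∑ k : Fin (n + 1), (n.choose k : R) *
      ((if (k : ℕ) = 0 ∨ n - k = 0 then 1 else y) * (peakPoly y k * peakPoly y (n - k)))

theorem Finset.sum_arrangements_pow_peakCount {α R : Type*} [LinearOrder α] [CommSemiring R]
    (y : R) (s : Finset α) : ∑ l ∈ s.arrangements, y ^ l.peakCount = peakPoly y s.card := by
  induction hn : s.card using Nat.strong_induction_on generalizing s with
  | _ n ih =>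
  subst hn
  obtain rfl | hs := s.eq_empty_or_nonempty
  · have : (∅ : Finset α).arrangements = {[]} := by
      ext l
      simp only [mem_arrangements, notMem_empty, iff_false, mem_singleton]
      rw [← List.eq_nil_iff_forall_not_mem]
      exact ⟨fun h => h.2, fun h => ⟨h ▸ List.nodup_nil, h⟩⟩
    simp [this, peakPoly, List.peakCount]
  · obtain ⟨m, t, hmt, hlt, rfl⟩ : ∃ m t, m ∉ t ∧ (∀ a ∈ t, a < m) ∧ s = insert m t :=
      ⟨s.max' hs, s.erase (s.max' hs), by simp,
        fun a ha => s.lt_max'_of_mem_erase_max' hs ha, by simp [max'_mem]⟩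
    rw [card_insert_of_notMem hmt] at ih ⊢
    rw [sum_arrangements_insert hmt, peakPoly, Fin.sum_univ_eq_sum_range (fun k =>
      (t.card.choose k : R) * ((if k = 0 ∨ t.card - k = 0 then 1 else y) *
        (peakPoly y k * peakPoly y (t.card - k))))]
    simp only [← nsmul_eq_mul (t.card.choose _)]
    rw [← sum_powerset_apply_card]
    refine sum_congr rfl fun u hu => ?_
    have hut := mem_powerset.1 hu
    have hc := card_le_card hut
    have hc' := card_sdiff_of_subset hut
    rw [← ih u.card (by omega) u rfl, ← hc', ← ih (t \ u).card (by omega) _ rfl,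
      sum_mul_sum, ← sum_product', mul_sum]
    refine sum_congr rfl ?_
    rintro ⟨l₁, l₂⟩ hl
    simp only [mem_product, mem_arrangements] at hl
    obtain ⟨⟨-, h₁⟩, -, h₂⟩ := hl
    have e₁ : l₁ = [] ↔ u.card = 0 := by
      rw [card_eq_zero, List.eq_nil_iff_forall_not_mem, eq_empty_iff_forall_notMem]
      simp [h₁]
    have e₂ : l₂ = [] ↔ (t \ u).card = 0 := by
      rw [card_eq_zero, List.eq_nil_iff_forall_not_mem, eq_empty_iff_forall_notMem]
      simp only [h₂]
    dsimp only
    rw [List.peakCount_append_cons (fun a ha => hlt a (hut ((h₁ a).1 ha)))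
      fun a ha => hlt a (mem_sdiff.1 ((h₂ a).1 ha)).1]
    simp only [e₁, e₂]
    split_ifs <;> ring

theorem sum_pow_numPeaks {R : Type*} [CommSemiring R] (y : R) (n : ℕ) :
    ∑ π : Equiv.Perm (Fin n), y ^ numPeaks π = peakPoly y n := by
  have := Finset.sum_arrangements_pow_peakCount y (Finset.univ : Finset (Fin n))
  rw [Finset.card_univ, Fintype.card_fin] at this
  rw [← this]
  refine Finset.sum_bij (fun π _ => List.ofFn π) ?_ ?_ ?_ ?_
  · intro π _
    rw [Finset.mem_arrangements, List.nodup_ofFn]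
    exact ⟨π.injective, fun a => by simpa [List.mem_ofFn] using π.surjective a⟩
  · intro π _ σ _ h
    exact Equiv.ext fun i => congrFun (List.ofFn_injective h) i
  · intro l hl
    rw [Finset.mem_arrangements] at hl
    obtain ⟨hn, hl⟩ := hl
    have hlen : l.length = n := by
      rw [← List.toFinset_card_of_nodup hn, show l.toFinset = Finset.univ by ext; simp [hl]]
      simp
    exact ⟨Equiv.ofBijective (fun i => l.get (i.cast hlen.symm)) (Finite.injective_iff_bijective.1
      ((List.nodup_iff_injective_get.1 hn).comp (Fin.cast_injective _))), Finset.mem_univ _,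
      List.ext_getElem (by simp [hlen]) (by simp)⟩
  · intro π _
    rw [peakCount_ofFn_perm]

theorem numValleys_eq_numPeaks_rev {n : ℕ} (π : Equiv.Perm (Fin n)) :
    numValleys π = numPeaks (π.trans Fin.revPerm) := by
  simp [numValleys, numPeaks, Fin.rev_lt_rev]

theorem sum_pow_numValleys {R : Type*} [CommSemiring R] (y : R) (n : ℕ) :
    ∑ π : Equiv.Perm (Fin n), y ^ numValleys π = peakPoly y n := by
  rw [← sum_pow_numPeaks]
  simp only [numValleys_eq_numPeaks_rev]
  exact Equiv.sum_comp (Equiv.mulLeft (Fin.revPerm : Equiv.Perm (Fin n)))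
    fun π => y ^ numPeaks π

theorem two_mul_numPeaks_le {n : ℕ} (π : Equiv.Perm (Fin n)) : 2 * numPeaks π ≤ n := by
  simpa [peakCount_ofFn_perm] using (List.ofFn π).two_mul_peakCount_le

/-! ### Formal differential equations -/

open PowerSeries in
theorem PowerSeries.eq_zero_of_derivative_eq_mul {R : Type*} [Field R] [CharZero R]
    {f g : PowerSeries R} (h : derivative R f = g * f) (h0 : coeff 0 f = 0) : f = 0 := by
  ext n
  rw [map_zero]
  induction n using Nat.strong_induction_on with
  | _ n ih =>
  cases n with
  | zero => exact h0
  | succ n =>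
    have := congrArg (coeff n) h
    rw [coeff_derivative, coeff_mul, Finset.sum_eq_zero] at this
    · exact (mul_eq_zero.1 this).resolve_right (Nat.cast_add_one_ne_zero n)
    · rintro ⟨i, j⟩ hij
      rw [Finset.HasAntidiagonal.mem_antidiagonal] at hij
      rw [ih j (by simp only at hij; omega), mul_zero]

/-- The exponential generating function of the peak polynomials. -/
noncomputable def peakSeries (y : ℂ) : PowerSeries ℂ :=
  PowerSeries.mk fun n => peakPoly y n / n.factorial

/-- The power series of `cos (s * X)`. -/
noncomputable def cosSeries (s : ℂ) : PowerSeries ℂ :=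
  PowerSeries.mk fun n => ((Complex.I * s) ^ n + (-(Complex.I * s)) ^ n) / (2 * n.factorial)

/-- The power series of `sin (s * X) / s`. -/
noncomputable def sinSeries (s : ℂ) : PowerSeries ℂ :=
  PowerSeries.mk fun n =>
    ((Complex.I * s) ^ n - (-(Complex.I * s)) ^ n) / (2 * (Complex.I * s) * n.factorial)

open PowerSeries

theorem derivative_peakSeries (y : ℂ) : derivative ℂ (peakSeries y) =
    1 + 2 * (peakSeries y - 1) + C y * (peakSeries y - 1) ^ 2 := by
  -- The four products record which sides of the maximum are empty; unsimplified, all are sums over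
  -- one antidiagonal.
  have key : derivative ℂ (peakSeries y) = (1 : PowerSeries ℂ) * 1 + 1 * (peakSeries y - 1) +
      (peakSeries y - 1) * 1 + C y * ((peakSeries y - 1) * (peakSeries y - 1)) := by
    ext n
    rw [map_add, map_add, map_add, coeff_C_mul]
    simp only [coeff_mul, Finset.mul_sum, ← Finset.sum_add_distrib]
    rw [coeff_derivative, peakSeries, coeff_mk, peakPoly, Fin.sum_univ_eq_sum_range (fun k =>
      (n.choose k : ℂ) * ((if k = 0 ∨ n - k = 0 then 1 else y) *
        (peakPoly y k * peakPoly y (n - k)))), ← Nat.succ_eq_add_one,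
      ← Finset.Nat.sum_antidiagonal_eq_sum_range_succ (fun i j =>
      (n.choose i : ℂ) * ((if i = 0 ∨ j = 0 then 1 else y) * (peakPoly y i * peakPoly y j))),
      Finset.sum_div, Finset.sum_mul]
    refine Finset.sum_congr rfl ?_
    rintro ⟨i, j⟩ hij
    rw [Finset.HasAntidiagonal.mem_antidiagonal] at hij
    simp only at hij
    subst hij
    have hc : ((i + j).choose i : ℂ) * (i.factorial * j.factorial) = (i + j).factorial := by
      have := Nat.choose_mul_factorial_mul_factorial (Nat.le_add_right i j)
      rw [Nat.add_sub_cancel_left] at this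
      rw [← mul_assoc]
      exact_mod_cast this
    have hi : (i.factorial : ℂ) ≠ 0 := Nat.cast_ne_zero.2 i.factorial_ne_zero
    have hj : (j.factorial : ℂ) ≠ 0 := Nat.cast_ne_zero.2 j.factorial_ne_zero
    have hn : ((i + j : ℕ) : ℂ) + 1 ≠ 0 := Nat.cast_add_one_ne_zero _
    have hs : ((i + j).choose i : ℂ) ≠ 0 :=
      Nat.cast_ne_zero.2 (Nat.choose_pos (Nat.le_add_right i j)).ne'
    have hL : ∀ c : ℂ, ((i + j).choose i : ℂ) * (c * (peakPoly y i * peakPoly y j)) /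
        (i + j).succ.factorial * ((i + j : ℕ) + 1) =
        c * (peakPoly y i / i.factorial * (peakPoly y j / j.factorial)) := by
      intro c
      rw [Nat.factorial_succ, Nat.cast_mul, ← hc, Nat.cast_succ]
      field_simp
    rw [hL]
    simp only [map_sub, coeff_mk, coeff_one]
    rcases eq_or_ne i 0 with rfl | hi0 <;> rcases eq_or_ne j 0 with rfl | hj0 <;>
      simp [*, peakPoly]
  rw [key]
  ring

theorem derivative_cosSeries (s : ℂ) (hs : s ≠ 0) :
    derivative ℂ (cosSeries s) = C (-s ^ 2) * sinSeries s := by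
  ext n
  have hn : (n.factorial : ℂ) ≠ 0 := Nat.cast_ne_zero.2 n.factorial_ne_zero
  have hn' : (n : ℂ) + 1 ≠ 0 := Nat.cast_add_one_ne_zero _
  have hI := Complex.I_ne_zero
  rw [coeff_derivative, coeff_C_mul, cosSeries, sinSeries, coeff_mk, coeff_mk,
    Nat.factorial_succ, Nat.cast_mul, Nat.cast_succ, pow_succ, pow_succ]
  field_simp
  linear_combination ((Complex.I * s) ^ n - (-(Complex.I * s)) ^ n) * Complex.I_sq

theorem derivative_sinSeries (s : ℂ) (hs : s ≠ 0) :
    derivative ℂ (sinSeries s) = cosSeries s := by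
  ext n
  have hn : (n.factorial : ℂ) ≠ 0 := Nat.cast_ne_zero.2 n.factorial_ne_zero
  have hn' : (n : ℂ) + 1 ≠ 0 := Nat.cast_add_one_ne_zero _
  have hI := Complex.I_ne_zero
  rw [coeff_derivative, cosSeries, sinSeries, coeff_mk, coeff_mk,
    Nat.factorial_succ, Nat.cast_mul, Nat.cast_succ, pow_succ, pow_succ]
  field_simp
  ring

theorem peakSeries_mul (y s : ℂ) (hs : s ≠ 0) (h : s ^ 2 = y - 1) :
    peakSeries y * (cosSeries s - sinSeries s) = cosSeries s := by
  have hC : (C (-s ^ 2) : PowerSeries ℂ) = 1 - C y := by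
    rw [h, neg_sub, map_sub, map_one]
  have : (peakSeries y - 1) * (cosSeries s - sinSeries s) - sinSeries s = 0 := by
    -- The Riccati equation makes the defect solve a homogeneous linear equation with zero initial
    -- value.
    refine eq_zero_of_derivative_eq_mul (g := 1 + C y * (peakSeries y - 1)) ?_ ?_
    · simp only [map_sub, Derivation.leibniz, smul_eq_mul, derivative_cosSeries s hs,
        derivative_sinSeries s hs, derivative_peakSeries, hC, derivative_one]
      ring
    · simp [peakSeries, sinSeries, peakPoly]
  linear_combination this

/-! ### Convergence and evaluation -/

theorem Complex.hasSum_pow_div_factorial (z : ℂ) :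
    HasSum (fun n : ℕ => z ^ n / (n.factorial : ℂ)) (Complex.exp z) := by
  rw [Complex.exp_eq_exp_ℂ]
  exact NormedSpace.expSeries_div_hasSum_exp z

theorem hasSum_cosSeries (s x : ℂ) :
    HasSum (fun n => coeff n (cosSeries s) * x ^ n) (Complex.cos (x * s)) := by
  have h₁ := Complex.hasSum_pow_div_factorial (x * s * Complex.I)
  have h₂ := Complex.hasSum_pow_div_factorial (-(x * s) * Complex.I)
  have h : (fun n => coeff n (cosSeries s) * x ^ n) = fun n =>
      ((x * s * Complex.I) ^ n / (n.factorial : ℂ) +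
        (-(x * s) * Complex.I) ^ n / (n.factorial : ℂ)) / 2 := by
    funext n
    have hn : (n.factorial : ℂ) ≠ 0 := Nat.cast_ne_zero.2 n.factorial_ne_zero
    rw [cosSeries, coeff_mk, show x * s * Complex.I = Complex.I * s * x by ring,
      show -(x * s) * Complex.I = -(Complex.I * s) * x by ring, mul_pow _ x, mul_pow _ x]
    field_simp
  rw [h]
  exact (h₁.add h₂).div_const 2

theorem hasSum_sinSeries (s x : ℂ) (hs : s ≠ 0) :
    HasSum (fun n => coeff n (sinSeries s) * x ^ n) (Complex.sin (x * s) / s) := by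
  have h₁ := Complex.hasSum_pow_div_factorial (x * s * Complex.I)
  have h₂ := Complex.hasSum_pow_div_factorial (-(x * s) * Complex.I)
  have hI := Complex.I_ne_zero
  have h : (fun n => coeff n (sinSeries s) * x ^ n) = fun n =>
      ((x * s * Complex.I) ^ n / (n.factorial : ℂ) -
        (-(x * s) * Complex.I) ^ n / (n.factorial : ℂ)) / (2 * (Complex.I * s)) := by
    funext n
    have hn : (n.factorial : ℂ) ≠ 0 := Nat.cast_ne_zero.2 n.factorial_ne_zero
    rw [sinSeries, coeff_mk, show x * s * Complex.I = Complex.I * s * x by ring,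
      show -(x * s) * Complex.I = -(Complex.I * s) * x by ring, mul_pow _ x, mul_pow _ x]
    field_simp
  have h' : Complex.sin (x * s) / s = (Complex.exp (x * s * Complex.I) -
      Complex.exp (-(x * s) * Complex.I)) / (2 * (Complex.I * s)) := by
    rw [Complex.sin.eq_1]
    field_simp
    linear_combination (Complex.exp (-(x * s * Complex.I)) - Complex.exp (x * s * Complex.I)) *
      Complex.I_sq
  rw [h, h']
  exact (h₁.sub h₂).div_const _

theorem summable_norm_peakSeries {x y : ℂ} (hx : ‖x‖ < 1) (hxy : ‖y‖ * ‖x‖ ^ 2 < 1) :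
    Summable fun n => ‖coeff n (peakSeries y) * x ^ n‖ := by
  set r := max ‖x‖ (√‖y‖ * ‖x‖) with hr
  have hr0 : 0 ≤ r := (norm_nonneg x).trans (le_max_left _ _)
  have hr1 : r < 1 := by
    refine max_lt hx ?_
    rw [← sq_lt_one_iff₀ (by positivity), mul_pow, Real.sq_sqrt (norm_nonneg y)]
    exact hxy
  -- Each factor `y` is paired with two factors `x`.
  have hk : ∀ k n, 2 * k ≤ n → ‖y‖ ^ k * ‖x‖ ^ n ≤ r ^ n := by
    intro k n h
    obtain ⟨m, rfl⟩ := Nat.exists_eq_add_of_le h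
    calc ‖y‖ ^ k * ‖x‖ ^ (2 * k + m) = (√‖y‖ * ‖x‖) ^ (2 * k) * ‖x‖ ^ m := by
          rw [mul_pow, pow_mul (√‖y‖), Real.sq_sqrt (norm_nonneg y), pow_add, mul_assoc]
      _ ≤ r ^ (2 * k) * r ^ m := by
          gcongr
          · exact le_max_right _ _
          · exact le_max_left _ _
      _ = r ^ (2 * k + m) := (pow_add _ _ _).symm
  refine (summable_geometric_of_lt_one hr0 hr1).of_nonneg_of_le (fun _ => norm_nonneg _) fun n => ?_
  have hn : (0 : ℝ) < n.factorial := Nat.cast_pos.2 n.factorial_pos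
  rw [peakSeries, coeff_mk, ← sum_pow_numPeaks, div_mul_eq_mul_div, norm_div, Complex.norm_natCast,
    div_le_iff₀ hn, Finset.sum_mul]
  calc _ ≤ ∑ π : Equiv.Perm (Fin n), ‖y ^ numPeaks π * x ^ n‖ := norm_sum_le _ _
    _ ≤ ∑ π : Equiv.Perm (Fin n), r ^ n := by
        gcongr with π
        rw [norm_mul, norm_pow, norm_pow]
        exact hk _ _ (two_mul_numPeaks_le π)
    _ = r ^ n * n.factorial := by
        simp [Fintype.card_perm, mul_comm]

theorem hasSum_peakSeries {x y s : ℂ} (hy0 : y ≠ 0) (hy1 : y ≠ 1) (hs : s ^ 2 = y - 1)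
    (hx : ‖x‖ < 1) (hxy : ‖y‖ * ‖x‖ ^ 2 < 1) :
    HasSum (fun n => coeff n (peakSeries y) * x ^ n)
      (1 - 1 / y + 1 / y * s * Complex.tan (x * s + Complex.arctan (1 / s))) := by
  have hs0 : s ≠ 0 := by
    rintro rfl
    exact hy1 (by linear_combination -hs)
  have hP := summable_norm_peakSeries hx hxy
  have hC := hasSum_cosSeries s x
  have hD := hC.sub (hasSum_sinSeries s x hs0)
  have hmul := tsum_mul_tsum_eq_tsum_sum_antidiagonal_of_summable_norm hP hD.summable.norm
  have hcauchy : ∀ n, ∑ kl ∈ Finset.HasAntidiagonal.antidiagonal n, coeff kl.1 (peakSeries y) * x ^ kl.1 *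
      (coeff kl.2 (cosSeries s) * x ^ kl.2 - coeff kl.2 (sinSeries s) * x ^ kl.2) =
      coeff n (cosSeries s) * x ^ n := by
    intro n
    conv_rhs => rw [← peakSeries_mul y s hs0 hs, coeff_mul, Finset.sum_mul]
    refine Finset.sum_congr rfl ?_
    rintro ⟨i, j⟩ hij
    rw [Finset.HasAntidiagonal.mem_antidiagonal] at hij
    simp only at hij
    rw [← hij, pow_add, map_sub]
    ring
  simp only [hcauchy] at hmul
  rw [hC.tsum_eq, hD.tsum_eq] at hmul
  have hP' := hP.of_norm.hasSum
  set p := ∑' n, coeff n (peakSeries y) * x ^ n with hp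
  -- A zero here would, by `hmul`, make cosine and sine vanish together, so no pole of the tangent
  -- is met.
  have hD0 : Complex.cos (x * s) - Complex.sin (x * s) / s ≠ 0 := by
    intro h
    have hc : Complex.cos (x * s) = 0 := by rw [← hmul, h, mul_zero]
    have hsin : Complex.sin (x * s) = 0 := by
      rw [hc, zero_sub, neg_eq_zero, div_eq_zero_iff] at h
      exact h.resolve_right hs0
    simpa [hc, hsin] using Complex.sin_sq_add_cos_sq (x * s)
  -- `arctan` is singular only at `±i`, which would force `y = 0`.
  have hI : ∀ t : ℂ, t ^ 2 = -1 → 1 / s ≠ t := by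
    rintro t ht rfl
    rw [div_pow, hs, one_pow, div_eq_iff (sub_ne_zero.2 hy1)] at ht
    exact hy0 (by linear_combination ht)
  have htan := Complex.tan_arctan (hI _ Complex.I_sq) (hI _ (by rw [neg_sq, Complex.I_sq]))
  set a := Complex.arctan (1 / s)
  have hca : Complex.cos a ≠ 0 := by
    intro h
    rw [Complex.tan_eq_sin_div_cos, h, div_zero] at htan
    exact one_div_ne_zero hs0 htan.symm
  have hsa : Complex.sin a = Complex.cos a / s := by
    rw [Complex.tan_eq_sin_div_cos, div_eq_iff hca] at htan
    rw [htan]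
    ring
  suffices h : p = 1 - 1 / y + 1 / y * s * Complex.tan (x * s + a) by
    rw [← h]
    exact hP'
  symm
  rw [Complex.tan_eq_sin_div_cos, Complex.sin_add, Complex.cos_add, hsa]
  rw [show Complex.cos (x * s) * Complex.cos a - Complex.sin (x * s) * (Complex.cos a / s) =
    Complex.cos a * (Complex.cos (x * s) - Complex.sin (x * s) / s) by ring,
    show Complex.sin (x * s) * Complex.cos a + Complex.cos (x * s) * (Complex.cos a / s) =
    Complex.cos a * (Complex.sin (x * s) + Complex.cos (x * s) / s) by ring,
    mul_div_mul_left _ _ hca]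
  have hp' : p = Complex.cos (x * s) / (Complex.cos (x * s) - Complex.sin (x * s) / s) :=
    eq_div_of_mul_eq hD0 hmul
  rw [hp', eq_div_iff hD0, add_mul, mul_assoc _ (_ / _), div_mul_cancel₀ _ hD0]
  field_simp
  linear_combination Complex.sin (x * s) * hs

theorem mainTheorem2 (x y s : ℂ) (hy0 : y ≠ 0) (hy1 : y ≠ 1) (hs : s ^ 2 = y - 1)
    (hx : ‖x‖ < 1) (hxy : ‖y‖ * ‖x‖ ^ 2 < 1) :
    HasSum
      (fun n : ℕ => ∑ π : Equiv.Perm (Fin n), y ^ numPeaks π * x ^ n / (Nat.factorial n : ℂ))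
      (1 - 1 / y + 1 / y * s * Complex.tan (x * s + Complex.arctan (1 / s))) ∧
    HasSum
      (fun n : ℕ => ∑ π : Equiv.Perm (Fin n), y ^ numValleys π * x ^ n / (Nat.factorial n : ℂ))
      (1 - 1 / y + 1 / y * s * Complex.tan (x * s + Complex.arctan (1 / s))) := by
  have h := hasSum_peakSeries hy0 hy1 hs hx hxy
  simp only [← Finset.sum_div, ← Finset.sum_mul, sum_pow_numPeaks, sum_pow_numValleys]
  simp only [peakSeries, coeff_mk, div_mul_eq_mul_div (peakPoly _ _)] at h
  exact ⟨h, h⟩
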